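/- Consider the $K$-user cache-aided MISO broadcast channel with an $L$-antenna transmitter, $L\ge 1$, and a library of $N\ge K$ equal-sized files. User $k$ receives $y_k=\mathbf h_k^\dagger\mathbf x+w_k$; in each communication block the joint law of the channel vectors $(\mathbf h_1,\dots,\mathbf h_K)\in(\mathbb C^{L})^K$ is absolutely continuous. Files are divided into $F\ge 1$ packets. An uncoded placement gives each user a set of packets whose size is at most a fraction $\gamma\in[0,1]$ of the library; $t=K\gamma$ is the cumulative cache size. For a demand of $K$ distinct files, a one-shot linear delivery consists of communication blocks. In a block the transmitter serves a set of users, sending to each of them one packet of its requested file that it has not cached, through a linear combination $\mathbf x=\sum_i s_i\mathbf p_i$ of the packets' coded symbols $s_i$. The precoders $\mathbf p_i$ are (measurable) functions of the channel vectors of those served users that feed back their channels. Almost surely, each served user must recover its symbol, up to a multiple of the noise, as a linear combination of $y_k$ and of the symbols of packets it has cached. Every requested packet missing at its user is sent to it in exactly one block. The feedback cost is at most $C$ if in every block at most $C$ users feed back their channels and at most $C$ distinct precoders are used; full CSIT means $C=K$. Let $\mathcal T^\star_L(t,C)$ be the infimum over $F$ and over placements of the maximum over demands of the least number of blocks divided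 by $F$, and let the optimal one-shot linear DoF be $\mathcal D_L(t,C)=K(1-\gamma)/\mathcal T^\star_L(t,C)$. Then for every integer $t$ with $0\le t<K$, the optimal DoF with full CSIT is $$\mathcal D_L(t)=\min\{L+t,\,K\},$$ that is, exactly $L+t$ whenever $L+t\le K$; and the same value $\mathcal D_L(t,C)=\min\{L+t,K\}$ is already the optimum for every feedback cost $C\ge L$, in particular for $C=L$. Moreover, for every real $\gamma\in[0,1]$ and every $C$, $\mathcal D_L(t,C)\le L+t$ (with $\mathcal D_L(t,C)$ read as $0$ when $\gamma=1$). -/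

import Mathlib

open MeasureTheory
open scoped ENNReal

noncomputable section

namespace CacheMISO

/-- A channel realization: row `k` is the channel vector `h_k ∈ ℂ^L` of user `k`. -/
abbrev Channel (K L : ℕ) : Type := Fin K → Fin L → ℂ

/-- An uncoded placement: each of the `K` users stores a set of packets. The library has
`N` files of `F` packets each; the packet `(n, f)` is the `f`-th packet of file `n`. -/
abbrev Placement (K N F : ℕ) : Type := Fin K → Finset (Fin N × Fin F)

/-- Every user stores at most a fraction `γ` of the library. -/
def Placement.Fits {K N F : ℕ} (Z : Placement K N F) (γ : ℝ) : Prop :=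
  ∀ k, ((Z k).card : ℝ) ≤ γ * ((N : ℝ) * (F : ℝ))

/-- One communication block of a one-shot linear scheme. Each user `k ∈ served` is sent the
packet `packet k` of its requested file (the value of `packet` off `served` plays no role);
`feedback` is the set of users whose channel vectors the transmitter knows; the beamforming
vector of user `k`'s packet is a function of those channel vectors only. -/
structure Block (K L F : ℕ) where
  served : Finset (Fin K)
  packet : Fin K → Fin F
  feedback : Finset (Fin K)
  precoder : Fin K → ({j // j ∈ feedback} → Fin L → ℂ) → Fin L → ℂ

variable {K N L F : ℕ}

/-- The transmitted vector `x ∈ ℂ^L`: the linear combination of the scheduled (channel-coded)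
packets, where `s i` is the symbol of the packet intended for user `i`. -/
def Block.transmitted (B : Block K L F) (H : Channel K L) (s : Fin K → ℂ) : Fin L → ℂ :=
  ∑ i ∈ B.served, s i • B.precoder i (fun j => H j)

/-- The received signal `y = h† x + w`. -/
def received (h x : Fin L → ℂ) (w : ℂ) : ℂ := star h ⬝ᵥ x + w

/-- User `k` obtains its desired symbol, up to a multiple of the noise, by a linear combination
of its received signal and of the scheduled packets that it has cached. -/
def Block.DecodableAt (B : Block K L F) (Z : Placement K N F) (d : Fin K ↪ Fin N)
    (H : Channel K L) (k : Fin K) : Prop :=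
  ∃ (a : ℂ) (c : Fin K → ℂ),
    (∀ i, (d i, B.packet i) ∉ Z k → c i = 0) ∧
    ∀ (s : Fin K → ℂ) (w : ℂ),
      a * received (H k) (B.transmitted H s) w + ∑ i ∈ B.served, c i * s i = s k + a * w

/-- The block is admissible at feedback cost `C` for the demand `d`: only packets missing at their
intended users are sent, at most `C` of the served users feed back their channels, at most `C`
different precoders are used, and almost surely every served user decodes its packet. -/
structure Block.Admissible (B : Block K L F) (μ : Measure (Channel K L)) (C : ℕ)
    (Z : Placement K N F) (d : Fin K ↪ Fin N) : Prop where
  needed : ∀ k ∈ B.served, (d k, B.packet k) ∉ Z k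
  feedback_subset : B.feedback ⊆ B.served
  feedback_card : B.feedback.card ≤ C
  precoder_card : (B.precoder '' (B.served : Set (Fin K))).ncard ≤ C
  precoder_measurable : ∀ k ∈ B.served, Measurable (B.precoder k)
  decodable : ∀ᵐ H ∂μ, ∀ k ∈ B.served, B.DecodableAt Z d H k

/-- `T` communication blocks of feedback cost at most `C` serve the demand `d`: every requested
packet that is missing at its user is sent to that user in exactly one block. -/
def Deliverable (μ : Measure (Channel K L)) (C : ℕ) (Z : Placement K N F) (d : Fin K ↪ Fin N)
    (T : ℕ) : Prop :=
  ∃ B : Fin T → Block K L F,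
    (∀ b, (B b).Admissible μ C Z d) ∧
    ∀ k f, (d k, f) ∉ Z k → ∃! b, k ∈ (B b).served ∧ (B b).packet k = f

/-- The minimum one-shot linear delivery time of a placement for the worst case of distinct
demands, in units of `F` communication blocks. -/
def placementTime (μ : Measure (Channel K L)) (C : ℕ) (Z : Placement K N F) : ℝ≥0∞ :=
  ⨆ d : Fin K ↪ Fin N, ⨅ (T : ℕ) (_ : Deliverable μ C Z d T), (T : ℝ≥0∞) / (F : ℝ≥0∞)

/-- The optimal worst-case delivery time: the infimum over all subdivisions of the files into
`F ≥ 1` packets and all uncoded placements with caches of normalized size `γ`. -/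
def deliveryTime (N : ℕ) (μ : Measure (Channel K L)) (γ : ℝ) (C : ℕ) : ℝ≥0∞ :=
  ⨅ (F : ℕ) (_ : 0 < F) (Z : Placement K N F) (_ : Z.Fits γ), placementTime μ C Z

/-- The optimal one-shot linear DoF, `K (1 - γ)` divided by the optimal delivery time, when the
feedback cost of each transmission is at most `C`. -/
def optimalDoF (N : ℕ) (μ : Measure (Channel K L)) (γ : ℝ) (C : ℕ) : ℝ≥0∞ :=
  ENNReal.ofReal ((K : ℝ) * (1 - γ)) / deliveryTime N μ γ C

/-- The optimal one-shot linear DoF with full CSIT: all `K` users may feed back their channels. -/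
def fullDoF (N : ℕ) (μ : Measure (Channel K L)) (γ : ℝ) : ℝ≥0∞ :=
  optimalDoF N μ γ K

end CacheMISO

end

/-! Converse: suppose a packet cached by `m` users lies in a block serving more than `L + m` users.
Its precoder is then orthogonal to the channels of at least `L` unintended users, which are
generically independent, so it vanishes (`Block.Admissible.card_served_le`). Weigh each such packet
by `1 / (L + m)`, so that every block carries total weight at most one. Averaging over cyclic
demands bounds the delivery time below by the mean of `(K - m) / (L + m)` over the library. This
function is convex and decreasing in `m`, and the mean of `m` is at most `K * γ`, which gives the
bound `L + K * γ` on the DoF (`div_le_deliveryTime`). The weight `1 / K` gives the bound `K`.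

Achievability: let `m = K - t` and `n = min L m`. An arrangement `g` puts `t` users in caching slots
and `m` in a cycle; its packets are cached by the former. A block serves all `t` caching users and
`n` consecutive cyclic users, the latter zero-forced among themselves. The caching user at slot `i`
gets a packet of the arrangement in which it trades places with the first served cyclic user. That
packet is cached by the first cyclic user and by all other caching users, so it can reuse the first
user's precoder. Caching users therefore need no nulling and no feedback, and cost `n ≤ L` suffices
for `n + t = min (L + t) K` users per block. -/

namespace CacheMISO

variable {K N L F : ℕ}

/-! ### Generic invertibility of channel submatrices -/

/-- The square matrix of conjugated channel coefficients from the antennas `ι` to the users `ρ`. -/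
def subchannel {n : ℕ} (H : Channel K L) (ρ : Fin n → Fin K) (ι : Fin n → Fin L) :
    Matrix (Fin n) (Fin n) ℂ :=
  Matrix.of fun e j => star (H (ρ e) (ι j))

theorem measurable_det_subchannel {n : ℕ} (ρ : Fin n → Fin K) (ι : Fin n → Fin L) :
    Measurable fun H : Channel K L => (subchannel H ρ ι).det := by
  apply Continuous.measurable
  unfold subchannel
  exact Continuous.matrix_det
    (continuous_matrix fun i j => by simp only [Matrix.of_apply]; fun_prop)

/-- Square submatrices of a generic channel matrix are invertible. -/
theorem ae_det_subchannel_ne_zero {n : ℕ} {ρ : Fin n → Fin K} (hρ : ρ.Injective)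
    {ι : Fin n → Fin L} (hι : ι.Injective) :
    ∀ᵐ H : Channel K L, (subchannel H ρ ι).det ≠ 0 := by
  classical
  -- A direction whose subchannel is the identity matrix.
  let V : Channel K L := fun k l => if ∃ e, ρ e = k ∧ ι e = l then 1 else 0
  have hV : subchannel V ρ ι = 1 := by
    ext e j
    have : (∃ a, ρ a = ρ e ∧ ι a = ι j) ↔ e = j :=
      ⟨fun ⟨a, h₁, h₂⟩ => (hρ h₁).symm.trans (hι h₂), fun h => ⟨e, rfl, by rw [h]⟩⟩
    simp only [subchannel, Matrix.of_apply, V, this, Matrix.one_apply]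
    split_ifs <;> simp
  have hms : MeasurableSet {H : Channel K L | (subchannel H ρ ι).det ≠ 0} :=
    (measurable_det_subchannel ρ ι) (measurableSet_singleton (0 : ℂ)).compl
  have : (volume : Measure (Fin L → ℂ)).IsAddHaarMeasure :=
    Measure.pi.isAddHaarMeasure fun _ => volume
  have : (volume : Measure (Channel K L)).IsAddHaarMeasure :=
    Measure.pi.isAddHaarMeasure fun _ => volume
  -- It suffices that almost every point of each line parallel to `V` is good. The lines are real
  -- because conjugation is only real-linear. For `A` the subchannel at `H`, the determinant along
  -- the line is `det (A + x • 1)`, the characteristic polynomial of `-A` at `x`, with finitely many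
  -- roots.
  refine ae_mem_of_ae_add_linearMap_mem (𝕜 := ℝ)
    (LinearMap.toSpanSingleton ℝ (Channel K L) V) (volume : Measure ℝ) volume hms fun H => ?_
  have hfin : {x : ℝ | (x : ℂ) ∈ ((-subchannel H ρ ι).charpoly.roots.toFinset : Set ℂ)}.Finite :=
    (Finset.finite_toSet _).preimage Complex.ofReal_injective.injOn
  filter_upwards [hfin.countable.ae_notMem volume] with x hx
  intro h0
  apply hx
  rw [LinearMap.toSpanSingleton_apply] at h0
  rw [Finset.mem_coe, Multiset.mem_toFinset]
  rw [Polynomial.mem_roots (Matrix.charpoly_monic _).ne_zero, Polynomial.IsRoot,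
    Matrix.eval_charpoly, ← h0]
  congr 1
  ext e j
  have hVej := congrFun (congrFun hV e) j
  simp only [subchannel, Matrix.of_apply] at hVej
  rw [← starRingEnd_apply] at hVej
  simp [subchannel, hVej, ← Matrix.smul_one_eq_diagonal, add_comm]

/-! ### Decodability and the size of a block -/

theorem Block.received_transmitted (B : Block K L F) (H : Channel K L) (h : Fin L → ℂ)
    (s : Fin K → ℂ) (w : ℂ) :
    received h (B.transmitted H s) w =
      ∑ i ∈ B.served, s i * (star h ⬝ᵥ B.precoder i fun j => H j) + w := by
  simp [received, Block.transmitted, dotProduct_sum, dotProduct_smul]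

/-- Decodability in terms of the effective channel gains `h_k† p_i`. -/
theorem Block.decodableAt_iff (B : Block K L F) (Z : Placement K N F) (d : Fin K ↪ Fin N)
    (H : Channel K L) {k : Fin K} (hk : k ∈ B.served) (hneed : (d k, B.packet k) ∉ Z k) :
    B.DecodableAt Z d H k ↔ (star (H k) ⬝ᵥ B.precoder k fun j => H j) ≠ 0 ∧
      ∀ i ∈ B.served, i ≠ k → (d i, B.packet i) ∉ Z k →
        (star (H k) ⬝ᵥ B.precoder i fun j => H j) = 0 := by
  classical
  constructor
  · rintro ⟨a, c, hc, h⟩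
    have key : ∀ i ∈ B.served, a * (star (H k) ⬝ᵥ B.precoder i fun j => H j) + c i =
        (Pi.single i 1 : Fin K → ℂ) k := by
      -- Probing with a unit symbol vector and zero noise isolates the coefficient of `s i`.
      intro i hi
      have := h (Pi.single i 1) 0
      simpa [received_transmitted, Pi.single_apply, hi] using this
    have hkk := key k hk
    rw [hc k hneed, Pi.single_eq_same, add_zero] at hkk
    refine ⟨right_ne_zero_of_mul_eq_one hkk, fun i hi hik hZ => ?_⟩
    have := key i hi
    rw [hc i hZ, Pi.single_eq_of_ne hik.symm, add_zero] at this
    exact (mul_eq_zero.1 this).resolve_left (left_ne_zero_of_mul_eq_one hkk)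
  · rintro ⟨h0, h⟩
    set gain : Fin K → ℂ := fun i => star (H k) ⬝ᵥ B.precoder i fun j => H j with hgain
    refine ⟨(gain k)⁻¹, fun i => if (d i, B.packet i) ∈ Z k then -((gain k)⁻¹ * gain i) else 0,
      fun i hi => if_neg hi, fun s w => ?_⟩
    rw [received_transmitted, mul_add, add_right_comm, Finset.mul_sum, ← Finset.sum_add_distrib,
      Finset.sum_eq_single_of_mem k hk]
    · beta_reduce
      rw [if_neg hneed, zero_mul, add_zero, mul_left_comm]
      change s k * ((gain k)⁻¹ * gain k) + _ = _
      rw [inv_mul_cancel₀ h0, mul_one]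
    · intro i hi hik
      change (gain k)⁻¹ * (s i * gain i) + _ = 0
      beta_reduce
      split_ifs with hZ
      · ring
      · rw [show gain i = 0 from h i hi hik hZ]; simp

/-- A block serves at most `L` users more than the number of users caching any packet in it. -/
theorem Block.Admissible.card_served_le {B : Block K L F} {μ : Measure (Channel K L)}
    [NeZero μ] (hμ : μ ≪ volume) {C : ℕ} {Z : Placement K N F} {d : Fin K ↪ Fin N}
    (hB : B.Admissible μ C Z d) {i : Fin K} (hi : i ∈ B.served) :
    B.served.card ≤ L + (Finset.univ.filter fun k => (d i, B.packet i) ∈ Z k).card := by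
  classical
  by_contra! hlt
  set T := Finset.univ.filter fun k => (d i, B.packet i) ∈ Z k with hT
  -- These are the served users, other than `i`, at which the packet must be nulled.
  have hU : L ≤ ((B.served.erase i) \ T).card := by
    have h₁ := Finset.le_card_sdiff T (B.served.erase i)
    rw [Finset.card_erase_of_mem hi] at h₁
    omega
  obtain ⟨ρ, hρ⟩ : ∃ ρ : Fin L ↪ Fin K, ∀ e, ρ e ∈ (B.served.erase i) \ T := by
    obtain ⟨U, hUs, hUc⟩ := Finset.exists_subset_card_eq hU
    refine ⟨(U.orderEmbOfFin hUc).toEmbedding, fun e => hUs (U.orderEmbOfFin_mem hUc e)⟩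
  have hgen : ∀ᵐ H ∂μ, (subchannel H ρ (id : Fin L → Fin L)).det ≠ 0 :=
    hμ.ae_le (ae_det_subchannel_ne_zero ρ.injective Function.injective_id)
  obtain ⟨H, hdet, hdec⟩ := (hgen.and hB.decodable).exists
  have hp : (B.precoder i fun j => H j) = 0 := by
    refine Matrix.eq_zero_of_mulVec_eq_zero hdet (funext fun e => ?_)
    have he := hρ e
    simp only [hT, Finset.mem_sdiff, Finset.mem_erase, Finset.mem_filter, Finset.mem_univ,
      true_and] at he
    exact ((B.decodableAt_iff Z d H he.1.2 (hB.needed _ he.1.2)).1 (hdec _ he.1.2)).2 i hi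
      he.1.1.symm he.2
  exact ((B.decodableAt_iff Z d H hi (hB.needed i hi)).1 (hdec i hi)).1 (by simp [hp])

/-! ### Converse by weighted counting -/

/-- The number of users caching the packet `p`. -/
def Placement.multiplicity (Z : Placement K N F) (p : Fin N × Fin F) : ℕ :=
  (Finset.univ.filter fun k => p ∈ Z k).card

theorem Placement.sum_multiplicity (Z : Placement K N F) :
    ∑ p, Z.multiplicity p = ∑ k, (Z k).card := by
  simp only [multiplicity, Finset.card_filter]
  rw [Finset.sum_comm]
  simp

theorem Placement.Fits.sum_multiplicity_le {Z : Placement K N F} {γ : ℝ} (hZ : Z.Fits γ) :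
    ∑ p, (Z.multiplicity p : ℝ) ≤ K * γ * (N * F) := by
  have h : ∑ p, (Z.multiplicity p : ℝ) = ∑ k, ((Z k).card : ℝ) := by
    exact_mod_cast Z.sum_multiplicity
  rw [h]
  refine (Finset.sum_le_sum fun k _ => hZ k).trans_eq ?_
  simp [mul_assoc]

/-- If `φ` weighs every packet by at most the inverse size of any block that may contain it, then
the total weight of the packets to be delivered is at most the number of blocks. -/
theorem Deliverable.sum_weight_le {μ : Measure (Channel K L)} {C : ℕ} {Z : Placement K N F}
    {d : Fin K ↪ Fin N} {T : ℕ} (h : Deliverable μ C Z d T) {φ : Fin N × Fin F → ℝ}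
    (hφ : ∀ p, 0 ≤ φ p)
    (hB : ∀ B : Block K L F, B.Admissible μ C Z d → ∀ i ∈ B.served,
      (B.served.card : ℝ) * φ (d i, B.packet i) ≤ 1) :
    ∑ k, ∑ f, (if (d k, f) ∈ Z k then 0 else φ (d k, f)) ≤ T := by
  classical
  obtain ⟨B, hadm, hdel⟩ := h
  calc ∑ k, ∑ f, (if (d k, f) ∈ Z k then 0 else φ (d k, f))
      ≤ ∑ k, ∑ f, ∑ b, (if k ∈ (B b).served ∧ (B b).packet k = f then φ (d k, f) else 0) := by
        refine Finset.sum_le_sum fun k _ => Finset.sum_le_sum fun f _ => ?_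
        have hnn : ∀ b ∈ Finset.univ,
            0 ≤ if k ∈ (B b).served ∧ (B b).packet k = f then φ (d k, f) else 0 := fun b _ => by
          split_ifs
          exacts [hφ _, le_rfl]
        split_ifs with hk
        · exact Finset.sum_nonneg hnn
        · obtain ⟨b, hb, -⟩ := hdel k f hk
          exact (if_pos hb).ge.trans (Finset.single_le_sum hnn (Finset.mem_univ b))
    _ = ∑ b, ∑ k ∈ (B b).served, φ (d k, (B b).packet k) := by
        simp_rw [Finset.sum_comm (s := (Finset.univ : Finset (Fin F)))]
        rw [Finset.sum_comm]
        refine Finset.sum_congr rfl fun b _ => ?_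
        simp [ite_and]
    _ ≤ ∑ _b : Fin T, 1 := by
        refine Finset.sum_le_sum fun b _ => ?_
        rcases (B b).served.eq_empty_or_nonempty with he | hne
        · simp [he]
        · have hc : (0 : ℝ) < (B b).served.card := by exact_mod_cast hne.card_pos
          refine (Finset.sum_le_sum fun k hk =>
            (le_div_iff₀' hc).2 (hB _ (hadm b) k hk)).trans_eq ?_
          rw [Finset.sum_const, nsmul_eq_mul]
          field_simp
    _ = T := by simp

/-- The demand of `K` consecutive files, cyclically, starting from file `j`. -/
def shiftDemand [NeZero N] (h : K ≤ N) (j : Fin N) : Fin K ↪ Fin N where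
  toFun k := Fin.castLE h k + j
  inj' _ _ hab := Fin.castLE_injective h (add_right_cancel hab)

/-- The worst demand is at least as costly as the average over the `N` cyclic shifts. Over these
shifts each user requests every file exactly once, so the packet `p` is counted once for each user
not caching it. -/
theorem ofReal_weight_le_placementTime {μ : Measure (Channel K L)} {C : ℕ}
    (Z : Placement K N F) [NeZero N] (hF : 0 < F) (hN : K ≤ N) {φ : Fin N × Fin F → ℝ}
    (hφ : ∀ p, 0 ≤ φ p)
    (hB : ∀ (d : Fin K ↪ Fin N) (B : Block K L F), B.Admissible μ C Z d → ∀ i ∈ B.served,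
      (B.served.card : ℝ) * φ (d i, B.packet i) ≤ 1) :
    ENNReal.ofReal ((∑ p, ((K : ℝ) - Z.multiplicity p) * φ p) / (N * F)) ≤
      placementTime μ C Z := by
  classical
  have hsum : ∑ p, ((K : ℝ) - Z.multiplicity p) * φ p =
      ∑ j : Fin N, ∑ k, ∑ f, (if (shiftDemand hN j k, f) ∈ Z k then 0
        else φ (shiftDemand hN j k, f)) := by
    rw [Finset.sum_comm]
    have h₁ : ∀ k : Fin K, ∑ j : Fin N, ∑ f, (if (shiftDemand hN j k, f) ∈ Z k then 0
        else φ (shiftDemand hN j k, f)) = ∑ p, if p ∈ Z k then 0 else φ p := fun k => by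
      rw [Fintype.sum_prod_type]
      exact Equiv.sum_comp (Equiv.addLeft (Fin.castLE hN k))
        fun n => ∑ f, if (n, f) ∈ Z k then 0 else φ (n, f)
    rw [Finset.sum_congr rfl fun k _ => h₁ k, Finset.sum_comm]
    refine Finset.sum_congr rfl fun p _ => ?_
    have hc : (K : ℝ) - Z.multiplicity p = (Finset.univ.filter fun k => p ∉ Z k).card := by
      have := Finset.card_filter_add_card_filter_not (s := (Finset.univ : Finset (Fin K)))
        (fun k => p ∈ Z k)
      rw [Finset.card_fin] at this
      rw [sub_eq_iff_eq_add', Placement.multiplicity]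
      exact_mod_cast this.symm
    rw [hc, Finset.sum_ite, Finset.sum_const_zero, zero_add, Finset.sum_const, nsmul_eq_mul]
  obtain ⟨j, -, hj⟩ : ∃ j ∈ (Finset.univ : Finset (Fin N)),
      (∑ p, ((K : ℝ) - Z.multiplicity p) * φ p) / N ≤
        ∑ k, ∑ f, (if (shiftDemand hN j k, f) ∈ Z k then 0 else φ (shiftDemand hN j k, f)) := by
    refine Finset.exists_le_of_sum_le ⟨0, Finset.mem_univ _⟩ ?_
    rw [← hsum, Finset.sum_const, Finset.card_fin, nsmul_eq_mul,
      mul_div_cancel₀ _ (NeZero.ne (N : ℝ))]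
  refine le_iSup_of_le (shiftDemand hN j) (le_iInf₂ fun T hT => ?_)
  have hF' : (0 : ℝ) < F := by exact_mod_cast hF
  rw [← div_div, ENNReal.ofReal_div_of_pos hF', ENNReal.ofReal_natCast]
  refine ENNReal.div_le_div_right (ENNReal.ofReal_le_of_le_toReal ?_) _
  rw [ENNReal.toReal_natCast]
  exact hj.trans (hT.sum_weight_le hφ (hB _))

/-- The converse on the delivery time for arbitrary cache sizes. -/
theorem div_le_deliveryTime {μ : Measure (Channel K L)} [NeZero μ] (hμ : μ ≪ volume)
    (hL : 1 ≤ L) (hN : K ≤ N) {γ : ℝ} (hγ : 0 ≤ γ) (C : ℕ) :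
    ENNReal.ofReal (K * (1 - γ) / (L + K * γ)) ≤ deliveryTime N μ γ C := by
  rcases Nat.eq_zero_or_pos K with rfl | hK
  · simp
  have : NeZero N := ⟨by omega⟩
  refine le_iInf₂ fun F hF => le_iInf₂ fun Z hZ => ?_
  have hL' : (1 : ℝ) ≤ L := by exact_mod_cast hL
  have hNF : (0 : ℝ) < N * F := by
    have : 0 < N * F := Nat.mul_pos (by omega) hF
    exact_mod_cast this
  refine le_trans (ENNReal.ofReal_le_ofReal ?_) (ofReal_weight_le_placementTime Z hF hN
    (φ := fun p => ((L : ℝ) + Z.multiplicity p)⁻¹) (fun p => by positivity) fun d B hB i hi => ?_)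
  · set b : ℝ := L + K * γ with hb
    have hb0 : 0 < b := by positivity
    rw [le_div_iff₀ hNF]
    -- With `y = L + multiplicity`, the right side is `(K + L) / y - 1`, and the left side is its
    -- tangent line at `y = b`. Being affine and decreasing in the multiplicity, it can be summed
    -- using only the total cache budget.
    have hterm : ∀ p : Fin N × Fin F, ((K : ℝ) + L) * (2 / b - (L + Z.multiplicity p) / b ^ 2) - 1 ≤
        ((K : ℝ) - Z.multiplicity p) * ((L : ℝ) + Z.multiplicity p)⁻¹ := fun p => by
      set y : ℝ := L + Z.multiplicity p with hy
      have hy0 : 0 < y := by positivity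
      have h₁ : 2 / b - y / b ^ 2 ≤ y⁻¹ := by
        rw [← sub_nonneg]
        have : y⁻¹ - (2 / b - y / b ^ 2) = (b - y) ^ 2 / (y * b ^ 2) := by
          field_simp
          ring
        rw [this]
        positivity
      have h₂ : ((K : ℝ) - Z.multiplicity p) * y⁻¹ = (K + L) * y⁻¹ - 1 := by
        rw [show ((K : ℝ) - Z.multiplicity p) = (K + L) - y by rw [hy]; ring]
        field_simp
      rw [h₂]
      gcongr
    refine le_trans ?_ (Finset.sum_le_sum fun p _ => hterm p)
    rw [Finset.sum_sub_distrib, ← Finset.mul_sum, Finset.sum_sub_distrib,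
      ← Finset.sum_div (f := fun p => (L : ℝ) + Z.multiplicity p), Finset.sum_add_distrib]
    simp only [Finset.sum_const, Finset.card_univ, Fintype.card_prod, Fintype.card_fin,
      nsmul_eq_mul, Nat.cast_mul, mul_one]
    have hm := hZ.sum_multiplicity_le
    have h₃ : ((N * F : ℝ) * L + ∑ p, (Z.multiplicity p : ℝ)) / b ^ 2 ≤ N * F / b := by
      rw [div_le_div_iff₀ (by positivity) hb0]
      have : (N * F : ℝ) * L + ∑ p, (Z.multiplicity p : ℝ) ≤ N * F * b := by rw [hb]; linarith
      nlinarith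
    have h₄ : (K * (1 - γ) / b) * (N * F) =
        ((K : ℝ) + L) * (N * F * (2 / b) - N * F / b) - N * F := by
      field_simp
      rw [hb]
      ring
    rw [h₄]
    gcongr
  · rw [← div_eq_mul_inv]
    refine div_le_one_of_le₀ ?_ (by positivity)
    exact_mod_cast hB.card_served_le hμ hi

/-- No block serves more than all `K` users. -/
theorem one_sub_le_deliveryTime (μ : Measure (Channel K L)) (hK : 0 < K) (hN : K ≤ N) (γ : ℝ)
    (C : ℕ) : ENNReal.ofReal (K * (1 - γ) / K) ≤ deliveryTime N μ γ C := by
  have : NeZero N := ⟨by omega⟩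
  refine le_iInf₂ fun F hF => le_iInf₂ fun Z hZ => ?_
  have hK' : (0 : ℝ) < K := by exact_mod_cast hK
  have hNF : (0 : ℝ) < N * F := by
    have : 0 < N * F := Nat.mul_pos (by omega) hF
    exact_mod_cast this
  refine le_trans (ENNReal.ofReal_le_ofReal ?_) (ofReal_weight_le_placementTime Z hF hN
    (φ := fun _ => (K : ℝ)⁻¹) (fun p => by positivity) fun d B hB i hi => ?_)
  · rw [le_div_iff₀ hNF, ← Finset.sum_mul, Finset.sum_sub_distrib, ← div_eq_mul_inv,
      div_mul_eq_mul_div]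
    simp only [Finset.sum_const, Finset.card_univ, Fintype.card_prod, Fintype.card_fin,
      nsmul_eq_mul, Nat.cast_mul]
    have hm := hZ.sum_multiplicity_le
    gcongr
    linarith
  · rw [← div_eq_mul_inv]
    refine div_le_one_of_le₀ ?_ hK'.le
    exact_mod_cast (Finset.card_le_univ _).trans_eq (Fintype.card_fin K)

theorem optimalDoF_le {μ : Measure (Channel K L)} {γ b : ℝ} {C : ℕ} (hb : 0 < b)
    (h : ENNReal.ofReal (K * (1 - γ) / b) ≤ deliveryTime N μ γ C) :
    optimalDoF N μ γ C ≤ ENNReal.ofReal b := by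
  refine ENNReal.div_le_of_le_mul ?_
  calc ENNReal.ofReal (K * (1 - γ)) = ENNReal.ofReal b * ENNReal.ofReal (K * (1 - γ) / b) := by
        rw [← ENNReal.ofReal_mul hb.le, mul_div_cancel₀ _ hb.ne']
    _ ≤ _ := by gcongr

/-! ### Zero-forcing blocks -/

/-- The zero-forcing precoder that nulls the channels `M a` with `a ≠ e`, on the first `n`
antennas. -/
def zfPrecoder {n : ℕ} (hn : n ≤ L) (M : Channel n L) (e : Fin n) : Fin L → ℂ :=
  ∑ b, (subchannel M id (Fin.castLE hn)).adjugate b e • Pi.single (Fin.castLE hn b) 1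

theorem measurable_zfPrecoder {n : ℕ} (hn : n ≤ L) (e : Fin n) :
    Measurable fun M : Channel n L => zfPrecoder hn M e := by
  apply Continuous.measurable
  unfold zfPrecoder
  have h : Continuous fun M : Channel n L =>
      (subchannel M id (Fin.castLE hn)).adjugate :=
    Continuous.matrix_adjugate
      (continuous_matrix fun i j => by simp only [subchannel, Matrix.of_apply]; fun_prop)
  exact continuous_finsetSum _ fun b _ => (h.matrix_elem b e).smul continuous_const

/-- The gain of the zero-forcing precoder is the determinant with the intended row replaced. -/
theorem star_dotProduct_zfPrecoder {n : ℕ} (hn : n ≤ L) (M : Channel n L) (e : Fin n)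
    (h : Fin L → ℂ) : star h ⬝ᵥ zfPrecoder hn M e =
      (subchannel (Function.update M e h) id (Fin.castLE hn)).det := by
  have hu : subchannel (Function.update M e h) id (Fin.castLE hn) =
      (subchannel M id (Fin.castLE hn)).updateRow e fun b => star (h (Fin.castLE hn b)) := by
    ext a b
    by_cases ha : a = e
    · subst ha; simp [subchannel]
    · simp [subchannel, ha]
  rw [hu, ← Matrix.cramer_transpose_apply, Matrix.cramer_eq_adjugate_mulVec,
    ← Matrix.adjugate_transpose, zfPrecoder, dotProduct_sum]
  simp [Matrix.mulVec, dotProduct, Pi.single_apply, mul_comm]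

section Block

variable {t n : ℕ} [NeZero n]

/-- The zero-forcing direction used at each slot: the users without feedback share the first. -/
def direction : Fin t ⊕ Fin n → Fin n := Sum.elim (fun _ => 0) id

/-- The block serving the users `ν r` with the packets `pkt r`. The users at the slots `inr e`
feed back their channels; those at the slots `inl i` share the precoder of the slot `inr 0`. -/
noncomputable def zfBlock (hn : n ≤ L) (ν : Fin t ⊕ Fin n → Fin K) (pkt : Fin t ⊕ Fin n → Fin F) :
    Block K L F where
  served := Finset.univ.image ν
  packet k := pkt (Function.invFun ν k)
  feedback := Finset.univ.image (ν ∘ Sum.inr)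
  precoder k Hf := zfPrecoder hn
    (fun e => Hf ⟨ν (Sum.inr e), Finset.mem_image_of_mem (ν ∘ Sum.inr) (Finset.mem_univ e)⟩)
    (direction (Function.invFun ν k))

/-- The gain of user `ν r` on its own precoder is the determinant of the channels of these users.
Their distinctness makes it generically nonzero, even when `ν r` gives no feedback. -/
theorem injective_update_direction {ν : Fin t ⊕ Fin n → Fin K} (hν : ν.Injective)
    (r : Fin t ⊕ Fin n) :
    (Function.update (ν ∘ Sum.inr) (direction r) (ν r)).Injective := by
  rcases r with i | e
  · intro a b hab
    by_cases ha : a = direction (.inl i : Fin t ⊕ Fin n) <;>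
      by_cases hb : b = direction (.inl i : Fin t ⊕ Fin n) <;>
      simp_all [hν.eq_iff]
  · have : Function.update (ν ∘ Sum.inr) (direction (.inr e : Fin t ⊕ Fin n)) (ν (.inr e)) =
        ν ∘ Sum.inr := Function.update_eq_self e (ν ∘ Sum.inr)
    rw [this]
    exact hν.comp Sum.inr_injective

/-- By `hnull`, uncached interference reaches only users with feedback, and only from precoders
aimed at another direction; zero-forcing removes exactly that. -/
theorem zfBlock_admissible {μ : Measure (Channel K L)} (hμ : μ ≪ volume) {C : ℕ} (hC : n ≤ C)
    {Z : Placement K N F} {d : Fin K ↪ Fin N} (hn : n ≤ L) {ν : Fin t ⊕ Fin n → Fin K}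
    (hν : ν.Injective) {pkt : Fin t ⊕ Fin n → Fin F}
    (hneed : ∀ r, (d (ν r), pkt r) ∉ Z (ν r))
    (hnull : ∀ r r', r ≠ r' → (d (ν r'), pkt r') ∉ Z (ν r) →
      ∃ e, r = Sum.inr e ∧ e ≠ direction r') :
    (zfBlock hn ν pkt).Admissible μ C Z d := by
  classical
  have hinv : ∀ r, Function.invFun ν (ν r) = r := Function.leftInverse_invFun hν
  have hneed' : ∀ k ∈ (zfBlock hn ν pkt).served, (d k, (zfBlock hn ν pkt).packet k) ∉ Z k := by
    intro k hk
    obtain ⟨r, -, rfl⟩ := Finset.mem_image.1 hk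
    simpa only [zfBlock, hinv] using hneed r
  refine ⟨hneed', ?_, ?_, ?_, ?_, ?_⟩
  · intro k hk
    obtain ⟨e, -, rfl⟩ := Finset.mem_image.1 hk
    exact Finset.mem_image_of_mem ν (Finset.mem_univ _)
  · exact (Finset.card_image_le.trans_eq (Finset.card_fin n)).trans hC
  · refine le_trans ?_ hC
    let P : Fin n → ({j // j ∈ (zfBlock hn ν pkt).feedback} → Fin L → ℂ) → Fin L → ℂ :=
      fun c Hf => zfPrecoder hn (fun e => Hf ⟨ν (Sum.inr e),
        Finset.mem_image_of_mem (ν ∘ Sum.inr) (Finset.mem_univ e)⟩) c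
    calc _ ≤ (Set.range P).ncard := Set.ncard_le_ncard (by
            rintro _ ⟨k, -, rfl⟩
            exact ⟨direction (Function.invFun ν k), rfl⟩) (Set.finite_range P)
      _ ≤ n := by
        rw [← Set.image_univ]
        exact (Set.ncard_image_le Set.finite_univ).trans_eq (by simp [Set.ncard_univ])
  · intro k _
    exact (measurable_zfPrecoder hn _).comp (measurable_pi_lambda _ fun e => measurable_pi_apply _)
  · have hgen : ∀ᵐ H ∂μ, ∀ r, (subchannel H
        (Function.update (ν ∘ Sum.inr) (direction r) (ν r)) (Fin.castLE hn)).det ≠ 0 :=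
      ae_all_iff.2 fun r => hμ.ae_le
        (ae_det_subchannel_ne_zero (injective_update_direction hν r) (Fin.castLE_injective hn))
    filter_upwards [hgen] with H hH k hk
    have hgain : ∀ r r', (star (H (ν r)) ⬝ᵥ (zfBlock hn ν pkt).precoder (ν r') fun j => H j) =
        (subchannel H (Function.update (ν ∘ Sum.inr) (direction r') (ν r))
          (Fin.castLE hn)).det := by
      intro r r'
      change star (H (ν r)) ⬝ᵥ zfPrecoder hn (fun e => H (ν (Sum.inr e)))
        (direction (Function.invFun ν (ν r'))) = _
      rw [star_dotProduct_zfPrecoder, hinv]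
      congr 1
      ext a b
      by_cases ha : a = direction r'
      · subst ha; simp [subchannel]
      · simp [subchannel, ha]
    rw [(zfBlock hn ν pkt).decodableAt_iff Z d H hk (hneed' k hk)]
    obtain ⟨r, -, rfl⟩ := Finset.mem_image.1 hk
    refine ⟨hgain r r ▸ hH r, fun i hi hir hiZ => ?_⟩
    obtain ⟨r', -, rfl⟩ := Finset.mem_image.1 hi
    obtain ⟨e, rfl, he⟩ := hnull r r' (fun h => hir (h ▸ rfl))
      (by simpa only [zfBlock, hinv] using hiZ)
    rw [hgain]
    -- Row `direction r'` has been replaced by the channel of the user at `inr e`, which already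
    -- occupies row `e`.
    refine Matrix.det_zero_of_row_eq he ?_
    ext b
    simp [subchannel, he]

end Block

/-! ### The placement and delivery scheme -/

section Scheme

variable {t m n : ℕ}

/-- The users are placed into `t` caching slots and `m` further, cyclically ordered, slots. -/
abbrev Arrangement (K t m : ℕ) : Type := (Fin t ⊕ Fin m) ≃ Fin K

/-- The slots served in the block with offset `c`: the caching ones and `n` consecutive others. -/
def slot [NeZero m] (hnm : n ≤ m) (c : Fin m) : Fin t ⊕ Fin n → Fin t ⊕ Fin m :=
  Sum.map id fun e => c + Fin.castLE hnm e

theorem slot_injective [NeZero m] (hnm : n ≤ m) (c : Fin m) : (slot (t := t) hnm c).Injective :=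
  Function.injective_id.sumMap fun _ _ h => Fin.castLE_injective hnm (add_left_cancel h)

/-- The arrangement labelling the packet that is sent to the user at slot `r`. -/
def relabel (g : Arrangement K t m) (c : Fin m) : Fin t ⊕ Fin n → Arrangement K t m :=
  Sum.elim (fun i => (Equiv.swap (Sum.inl i) (Sum.inr c)).trans g) fun _ => g

/-- Each file has one packet for every arrangement and every served slot. -/
abbrev Label (K t m n : ℕ) : Type := Arrangement K t m × (Fin t ⊕ Fin n)

/-- The packets of an arrangement are cached at the users in its caching slots. -/
noncomputable def arrangementPlacement (K N t m n : ℕ) :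
    Placement K N (Fintype.card (Label K t m n)) :=
  fun k => Finset.univ.filter fun p => ∃ i, ((Fintype.equivFin (Label K t m n)).symm p.2).1
    (Sum.inl i) = k

theorem mem_arrangementPlacement {k : Fin K} {a : Fin N} {q : Label K t m n} :
    (a, Fintype.equivFin _ q) ∈ arrangementPlacement K N t m n k ↔ ∃ i, q.1 (Sum.inl i) = k := by
  simp [arrangementPlacement]

theorem notMem_arrangementPlacement {k : Fin K} {a : Fin N} {q : Label K t m n} :
    (a, Fintype.equivFin _ q) ∉ arrangementPlacement K N t m n k ↔
      ∃ j, q.1 (Sum.inr j) = k := by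
  rw [mem_arrangementPlacement]
  obtain ⟨x, rfl⟩ := q.1.surjective k
  rcases x with i | j <;> simp

theorem multiplicity_arrangementPlacement (p : Fin N × Fin (Fintype.card (Label K t m n))) :
    (arrangementPlacement K N t m n).multiplicity p = t := by
  obtain ⟨a, f⟩ := p
  obtain ⟨q, rfl⟩ := (Fintype.equivFin (Label K t m n)).surjective f
  simp only [Placement.multiplicity, mem_arrangementPlacement]
  have : (Finset.univ.filter fun k => ∃ i, q.1 (Sum.inl i) = k) =
      Finset.univ.image fun i : Fin t => q.1 (Sum.inl i) := by
    ext k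
    simp
  rw [this, Finset.card_image_of_injective _ fun _ _ h =>
    Sum.inl_injective (q.1.injective h), Finset.card_fin]

/-- Composing every arrangement with the transposition of `k` and `k'` permutes the packets and
exchanges the two caches. -/
theorem card_arrangementPlacement_eq (k k' : Fin K) :
    (arrangementPlacement K N t m n k).card = (arrangementPlacement K N t m n k').card := by
  let σ : Label K t m n ≃ Label K t m n :=
    ((Equiv.refl _).equivCongr (Equiv.swap k k')).prodCongr (Equiv.refl _)
  refine Finset.card_equiv ((Equiv.refl (Fin N)).prodCongr
    ((Fintype.equivFin _).symm.trans (σ.trans (Fintype.equivFin _)))) fun p => ?_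
  obtain ⟨a, f⟩ := p
  obtain ⟨q, rfl⟩ := (Fintype.equivFin (Label K t m n)).surjective f
  have hσ : ((Equiv.refl (Fin N)).prodCongr ((Fintype.equivFin (Label K t m n)).symm.trans
      (σ.trans (Fintype.equivFin _)))) (a, Fintype.equivFin _ q) =
      (a, Fintype.equivFin _ (σ q)) := by simp
  rw [hσ, mem_arrangementPlacement, mem_arrangementPlacement]
  refine exists_congr fun i => ?_
  change _ ↔ Equiv.swap k k' (q.1 (Sum.inl i)) = k'
  rw [Equiv.swap_apply_eq_iff, Equiv.swap_apply_right]

theorem fits_arrangementPlacement (K N t m n : ℕ) :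
    (arrangementPlacement K N t m n).Fits (t / K) := by
  intro k
  have hsum := (arrangementPlacement K N t m n).sum_multiplicity
  simp only [multiplicity_arrangementPlacement, card_arrangementPlacement_eq _ k,
    Finset.sum_const, Finset.card_univ, Fintype.card_fin, Fintype.card_prod (Fin N),
    smul_eq_mul] at hsum
  have hK : (0 : ℝ) < K := by exact_mod_cast k.pos
  rw [div_mul_eq_mul_div, le_div_iff₀ hK]
  have : (N * Fintype.card (Label K t m n) * t : ℝ) =
      K * (arrangementPlacement K N t m n k).card := by exact_mod_cast hsum
  linarith

/-- Every missing packet is sent in exactly one block. -/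
theorem existsUnique_arrangement [NeZero m] (hnm : n ≤ m) (g' : Arrangement K t m)
    (r : Fin t ⊕ Fin n) (q : Fin m) : ∃! x : Arrangement K t m × Fin m,
      x.1 (slot hnm x.2 r) = g' (Sum.inr q) ∧ relabel x.1 x.2 r = g' := by
  rcases r with i | e
  -- The swap is an involution, so `g'` determines the arrangement of the block once the offset is
  -- known; the recipient, at cyclic slot `q` of `g'`, forces the offset to be `q`.
  · refine ⟨((Equiv.swap (Sum.inl i) (Sum.inr q)).trans g', q), ⟨?_, ?_⟩, ?_⟩
    · simp [slot]
    · ext x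
      simp [relabel]
    · rintro ⟨g, c⟩ ⟨h₁, h₂⟩
      simp only [relabel, Sum.elim_inl] at h₂
      subst h₂
      have hcq : c = q := by
        simp only [slot, Sum.map_inl, id, Equiv.trans_apply, g.injective.eq_iff] at h₁
        rw [eq_comm, Equiv.swap_apply_eq_iff, Equiv.swap_apply_left] at h₁
        exact (Sum.inr_injective h₁).symm
      subst hcq
      refine Prod.ext ?_ rfl
      ext x
      simp
  · refine ⟨(g', q - Fin.castLE hnm e), ⟨?_, rfl⟩, ?_⟩
    · simp [slot]
    · rintro ⟨g, c⟩ ⟨h₁, h₂⟩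
      simp only [relabel, Sum.elim_inr] at h₂
      subst h₂
      simp only [slot, Sum.map_inr, g.injective.eq_iff, Sum.inr.injEq] at h₁
      exact Prod.ext rfl (eq_sub_of_add_eq h₁)

/-- One block is used for each arrangement and offset. Caches remove all interference at caching
users and all interference from caching users' packets at the first cyclic user; zero-forcing
handles the rest. -/
theorem deliverable_arrangementPlacement [NeZero m] [NeZero n] {μ : Measure (Channel K L)} 
    (hμ : μ ≪ volume) {C : ℕ} (hC : n ≤ C) (hn : n ≤ L) (hnm : n ≤ m) (d : Fin K ↪ Fin N) :
    Deliverable μ C (arrangementPlacement K N t m n) d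
      (Fintype.card (Arrangement K t m × Fin m)) := by
  let idx := Fintype.equivFin (Label K t m n)
  let B : Arrangement K t m × Fin m → Block K L (Fintype.card (Label K t m n)) := fun x =>
    zfBlock hn (x.1 ∘ slot hnm x.2) fun r => idx (relabel x.1 x.2 r, r)
  have hinj : ∀ x : Arrangement K t m × Fin m, (x.1 ∘ slot (t := t) hnm x.2).Injective :=
    fun x => x.1.injective.comp (slot_injective hnm x.2)
  refine ⟨fun b => B ((Fintype.equivFin _).symm b), fun b => ?_, fun k f hk => ?_⟩
  · beta_reduce
    obtain ⟨g, c⟩ := (Fintype.equivFin (Arrangement K t m × Fin m)).symm b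
    refine zfBlock_admissible hμ hC hn (hinj (g, c)) ?_ ?_
    · rintro (i | e)
      · exact notMem_arrangementPlacement.2 ⟨c, by simp [relabel, slot]⟩
      · exact notMem_arrangementPlacement.2 ⟨c + Fin.castLE hnm e, by simp [relabel, slot]⟩
    · intro r r' hne hr
      rw [mem_arrangementPlacement] at hr
      rcases r with i | e
      · rcases r' with i' | e'
        -- The swap for slot `i'` leaves slot `i` in place, so this user caches the packet.
        · exact absurd ⟨i, by
            simp only [relabel, Sum.elim_inl, Equiv.trans_apply]
            rw [Equiv.swap_apply_of_ne_of_ne (by simpa using hne) (by simp)]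
            rfl⟩ hr
        · exact absurd ⟨i, rfl⟩ hr
      · refine ⟨e, rfl, ?_⟩
        rcases r' with i' | e'
        -- If `e = 0`, this is the user that the swap moved into the caching slot `i'`, so it would
        -- have the packet cached.
        · rintro rfl
          exact hr ⟨i', by
            have h0 : Fin.castLE hnm 0 = 0 := Fin.ext (by simp)
            simp [relabel, slot, direction, h0]⟩
        · simpa [direction] using hne
  · obtain ⟨⟨g', r⟩, rfl⟩ := idx.surjective f
    obtain ⟨q, rfl⟩ := notMem_arrangementPlacement.1 hk
    -- The slot recorded in the packet label fixes the position at which the packet can be sent,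
    -- reducing uniqueness to `existsUnique_arrangement`.
    have hiff : ∀ x : Arrangement K t m × Fin m,
        (g' (Sum.inr q) ∈ (B x).served ∧ (B x).packet (g' (Sum.inr q)) = idx (g', r)) ↔
          x.1 (slot hnm x.2 r) = g' (Sum.inr q) ∧ relabel x.1 x.2 r = g' := by
      intro x
      have hinv : ∀ r, Function.invFun (x.1 ∘ slot (t := t) hnm x.2) (x.1 (slot hnm x.2 r)) = r :=
        Function.leftInverse_invFun (hinj x)
      constructor
      · rintro ⟨h₁, h₂⟩
        obtain ⟨r', -, hr'⟩ := Finset.mem_image.1 h₁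
        rw [← hr'] at h₂ ⊢
        simp only [B, zfBlock, Function.comp_apply, hinv, idx.injective.eq_iff,
          Prod.mk.injEq] at h₂
        obtain ⟨h₂, rfl⟩ := h₂
        exact ⟨rfl, h₂⟩
      · rintro ⟨h₁, h₂⟩
        rw [← h₁]
        refine ⟨Finset.mem_image_of_mem (x.1 ∘ slot hnm x.2) (Finset.mem_univ r), ?_⟩
        simp only [B, zfBlock, hinv, h₂]
    obtain ⟨x, hx, hux⟩ := existsUnique_arrangement hnm g' r q
    refine ⟨Fintype.equivFin _ x, ?_, fun b hb => ?_⟩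
    · beta_reduce
      rw [Equiv.symm_apply_apply]
      exact (hiff x).2 hx
    · exact ((Fintype.equivFin _).symm_apply_eq).1 (hux _ ((hiff _).1 hb))

end Scheme

/-! ### The optimal DoF -/

/-- With `G` arrangements there are `G * m` blocks and `G * (t + n)` packets per file; `G` cancels.
-/
theorem deliveryTime_le {μ : Measure (Channel K L)} (hμ : μ ≪ volume) {t m n C : ℕ}
    (hK : t + m = K) (hm : 0 < m) (hn : 0 < n) (hnm : n ≤ m) (hnL : n ≤ L) (hC : n ≤ C) :
    deliveryTime N μ (t / K) C ≤ (m : ℝ≥0∞) / ((n + t : ℕ) : ℝ≥0∞) := by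
  have : NeZero m := ⟨hm.ne'⟩
  have : NeZero n := ⟨hn.ne'⟩
  have e : Arrangement K t m := finSumFinEquiv.trans (finCongr hK)
  have hG : 0 < Fintype.card (Arrangement K t m) := Fintype.card_pos_iff.2 ⟨e⟩
  have hF : 0 < Fintype.card (Label K t m n) := Fintype.card_pos_iff.2 ⟨(e, Sum.inr 0)⟩
  refine (iInf₂_le _ hF).trans ((iInf₂_le (arrangementPlacement K N t m n)
    (fits_arrangementPlacement K N t m n)).trans (iSup_le fun d => (iInf₂_le _
      (deliverable_arrangementPlacement hμ hC hnL hnm d)).trans_eq ?_))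
  rw [Fintype.card_prod, Fintype.card_prod, Fintype.card_sum, Fintype.card_fin, Fintype.card_fin,
    Fintype.card_fin, add_comm n t, Nat.cast_mul, Nat.cast_mul]
  exact ENNReal.mul_div_mul_left _ _ (by exact_mod_cast hG.ne') (ENNReal.natCast_ne_top _)

/-- The hypothesis on `C` is what the scheme needs with `n = min L (K - t)`; it covers both full
CSIT `C = K` and every `C ≥ L`. -/
theorem optimalDoF_eq {μ : Measure (Channel K L)} [NeZero μ] (hμ : μ ≪ volume) (hL : 1 ≤ L)
    (hN : K ≤ N) {t C : ℕ} (ht : t < K) (hC : min L (K - t) ≤ C) :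
    optimalDoF N μ (t / K) C = ((min (L + t) K : ℕ) : ℝ≥0∞) := by
  have hK : (0 : ℝ) < K := by exact_mod_cast (by omega : 0 < K)
  have hL' : (1 : ℝ) ≤ L := by exact_mod_cast hL
  refine le_antisymm ?_ ?_
  · rcases le_total (L + t) K with h | h
    · rw [min_eq_left h]
      refine (optimalDoF_le (b := L + t) (by positivity) ?_).trans_eq ?_
      · have := div_le_deliveryTime (N := N) hμ hL hN (γ := t / K) (by positivity) C
        rwa [mul_div_cancel₀ _ hK.ne'] at this
      · rw [← Nat.cast_add, ENNReal.ofReal_natCast]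
    · rw [min_eq_right h]
      exact (optimalDoF_le hK (one_sub_le_deliveryTime μ (by omega) hN _ C)).trans_eq
        (ENNReal.ofReal_natCast K)
  · have hD := deliveryTime_le (N := N) hμ (Nat.add_sub_cancel' ht.le) (by omega : 0 < K - t)
      (by omega : 0 < min L (K - t)) (min_le_right _ _) (min_le_left _ _) hC
    have hnum : ENNReal.ofReal (K * (1 - t / K)) = ((K - t : ℕ) : ℝ≥0∞) := by
      rw [← ENNReal.ofReal_natCast, Nat.cast_sub ht.le]
      congr 1
      field_simp
    rw [show min L (K - t) + t = min (L + t) K by omega] at hD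
    rw [optimalDoF, hnum]
    refine le_trans ?_ (ENNReal.div_le_div_left hD _)
    have hm0 : ((K - t : ℕ) : ℝ≥0∞) ≠ 0 := by exact_mod_cast (by omega : K - t ≠ 0)
    have hm1 : ((K - t : ℕ) : ℝ≥0∞) ≠ ⊤ := ENNReal.natCast_ne_top _
    rw [ENNReal.le_div_iff_mul_le (Or.inr hm0) (Or.inr hm1)]
    exact ENNReal.mul_div_le

end CacheMISO

theorem mainTheorem3 (K N L : ℕ) (hL : 1 ≤ L) (hN : K ≤ N)
    (μ : MeasureTheory.Measure (CacheMISO.Channel K L)) [MeasureTheory.IsProbabilityMeasure μ]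
    (hμ : μ.AbsolutelyContinuous MeasureTheory.volume) :
    (∀ t : ℕ, t < K →
      CacheMISO.fullDoF N μ ((t : ℝ) / (K : ℝ)) = ((min (L + t) K : ℕ) : ENNReal) ∧
      ∀ C : ℕ, L ≤ C →
        CacheMISO.optimalDoF N μ ((t : ℝ) / (K : ℝ)) C = ((min (L + t) K : ℕ) : ENNReal)) ∧
    ∀ γ : ℝ, 0 ≤ γ → γ ≤ 1 → ∀ C : ℕ,
      CacheMISO.optimalDoF N μ γ C ≤ ENNReal.ofReal ((L : ℝ) + (K : ℝ) * γ) := by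
  refine ⟨fun t ht => ⟨?_, fun C hC => ?_⟩, fun γ hγ _ C => ?_⟩
  · exact CacheMISO.optimalDoF_eq hμ hL hN ht (by omega)
  · exact CacheMISO.optimalDoF_eq hμ hL hN ht (by omega)
  · have hL' : (1 : ℝ) ≤ L := by exact_mod_cast hL
    exact CacheMISO.optimalDoF_le (by positivity) (CacheMISO.div_le_deliveryTime hμ hL hN hγ C)
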